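/- Let $(X_i)_{i\ge 1}$ be i.i.d. real random variables with $\mathbb E X_1=0$, $\mathbb V X_1=1$ and $\mathbb E\, e^{\lambda X_1}<\infty$ for all $\lambda\in(-D,D)$, for some $D>0$. For each $p\in(0,1]$ let $\nu_p$ be a random variable on the same probability space, independent of the sequence $(X_i)_{i\ge 1}$ and geometrically distributed with parameter $p$ on $\{1,2,3,\dots\}$, i.e. $\mathbb P(\nu_p=k)=(1-p)^{k-1}p$ for $k\ge 1$ (so that $\mathbb E\,\nu_p=1/p$). Let $0<\alpha<\tfrac12$ and $$Z_{p,\alpha}:=p^{\frac12+\alpha}\sum_{i=1}^{\nu_p}X_i .$$ Then, as $p\downarrow 0$, the family $(Z_{p,\alpha})_p$ satisfies a moderate deviation principle with speed $p^{-\alpha}$ and good rate function $J(y)=\sqrt2\,|y|$. That is, $p^{-\alpha}\to\infty$, $J\ge 0$ has compact level sets $\{y\in\mathbb R: J(y)\le L\}$ for all $L\ge0$, for every open $G\subseteq\mathbb R$ $$\liminf_{p\downarrow0}\,p^{\alpha}\log\mathbb P(Z_{p,\alpha}\in G)\ \ge\ -\inf_{y\in G}J(y),$$ and for every closed $A\subseteq\mathbb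 R$ $$\limsup_{p\downarrow0}\,p^{\alpha}\log\mathbb P(Z_{p,\alpha}\in A)\ \le\ -\inf_{y\in A}J(y),$$ where $\log 0=-\infty$ and $\inf\emptyset=+\infty$. -/

import Mathlib

open MeasureTheory ProbabilityTheory Filter Topology

/-- The family `(Y i)` of real random variables satisfies, along the filter `l`, a large deviation
principle with speed `v` and good rate function `I`. Formally a moderate deviation principle is the
same notion. Logarithms and infima take values in `[-∞, ∞]`, so that `log 0 = -∞` and the infimum
over the empty set is `∞`. -/
structure SatisfiesLDP {ι Ω : Type*} [MeasurableSpace Ω] (l : Filter ι) (P : Measure Ω)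
    (Y : ι → Ω → ℝ) (v : ι → ℝ) (I : ℝ → ℝ) : Prop where
  tendsto_speed : Tendsto v l atTop
  rate_nonneg : ∀ x, 0 ≤ I x
  isCompact_level : ∀ L : ℝ, 0 ≤ L → IsCompact {x : ℝ | I x ≤ L}
  lower_bound : ∀ G : Set ℝ, IsOpen G →
    -(⨅ x ∈ G, ((I x : ℝ) : EReal)) ≤
      liminf (fun i ↦ ((1 / v i : ℝ) : EReal) * ENNReal.log (P {ω | Y i ω ∈ G})) l
  upper_bound : ∀ A : Set ℝ, IsClosed A →
    limsup (fun i ↦ ((1 / v i : ℝ) : EReal) * ENNReal.log (P {ω | Y i ω ∈ A})) l ≤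
      -(⨅ x ∈ A, ((I x : ℝ) : EReal))

/-- The geometric law on `{1, 2, 3, …}` with parameter `p`, which gives mass `(1 - p) ^ (k - 1) * p`
to `k` and has mean `1 / p` for `0 < p`. Mathlib's `geometricMeasure` is supported on
`{0, 1, 2, …}`, whence the shift. -/
noncomputable def shiftedGeometric (p : unitInterval) : Measure ℕ :=
  (geometricMeasure p).map (fun n ↦ n + 1)

/-- The rescaled random sum `Z_{p,α} = p ^ (1/2 + α) * (X 0 + ⋯ + X (N - 1))`. -/
noncomputable def rescaledRandomSum {Ω : Type*} (X : ℕ → Ω → ℝ) (N : Ω → ℕ) (p α : ℝ) (ω : Ω) : ℝ :=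
  p ^ (1 / 2 + α : ℝ) * ∑ i ∈ Finset.range (N ω), X i ω

lemma AnalyticAt.tendsto_deriv_div {f : ℝ → ℝ} (hf : AnalyticAt ℝ f 0) (h1 : deriv f 0 = 0) :
    Tendsto (fun t ↦ deriv f t / t) (𝓝[≠] 0) (𝓝 (iteratedDeriv 2 f 0)) := by
  have := hasDerivAt_iff_tendsto_slope.1 hf.deriv.differentiableAt.hasDerivAt
  rw [iteratedDeriv_succ, iteratedDeriv_one]
  refine this.congr fun t ↦ ?_
  simp [slope_def_field, h1]

/-- Second order expansion at `0` of an analytic function with vanishing value and derivative. -/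
lemma AnalyticAt.tendsto_div_sq {f : ℝ → ℝ} (hf : AnalyticAt ℝ f 0) (h0 : f 0 = 0)
    (h1 : deriv f 0 = 0) :
    Tendsto (fun t ↦ f t / t ^ 2) (𝓝[≠] 0) (𝓝 (iteratedDeriv 2 f 0 / 2)) := by
  refine HasDerivAt.lhopital_zero_nhdsNE (f' := deriv f) (g' := fun t ↦ 2 * t) ?_ ?_ ?_ ?_ ?_ ?_
  · exact (hf.eventually_analyticAt.filter_mono nhdsWithin_le_nhds).mono
      fun t ht ↦ ht.differentiableAt.hasDerivAt
  · exact .of_forall fun t ↦ by simpa using hasDerivAt_pow 2 t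
  · filter_upwards [self_mem_nhdsWithin] with t ht
    exact mul_ne_zero two_ne_zero ht
  · simpa [h0] using hf.continuousAt.tendsto.mono_left (nhdsWithin_le_nhds (s := {0}ᶜ))
  · have : Tendsto (fun t : ℝ ↦ t ^ 2) (𝓝 0) (𝓝 (0 ^ 2)) := (continuous_pow 2).tendsto 0
    simpa using this.mono_left (nhdsWithin_le_nhds (s := {0}ᶜ))
  · refine ((hf.tendsto_deriv_div h1).div_const 2).congr fun t ↦ ?_
    rw [div_div, mul_comm]

/-- Change of measure bound for the probability of an interval. -/
lemma exp_mul_tilted_abs_sub_lt_le {Ω : Type*} [MeasurableSpace Ω] {μ : Measure Ω}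
    [IsProbabilityMeasure μ] {Y : Ω → ℝ} (hY : Measurable Y) {t : ℝ}
    (ht : Integrable (fun ω ↦ Real.exp (t * Y ω)) μ) (m r : ℝ) :
    Real.exp (cgf Y μ t - t * m - |t| * r) * (μ.tilted (t * Y ·)).real {ω | |Y ω - m| < r} ≤
      μ.real {ω | |Y ω - m| < r} := by
  set B : Set Ω := {ω | |Y ω - m| < r}
  have hB : MeasurableSet B := measurableSet_lt (by fun_prop) measurable_const
  have hle : (μ.tilted (t * Y ·)).real B ≤ Real.exp (t * m + |t| * r - cgf Y μ t) * μ.real B := by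
    rw [measureReal_def, tilted_mul_apply_eq_ofReal_integral_cgf' hB ht,
      ENNReal.toReal_ofReal (integral_nonneg fun _ ↦ (Real.exp_pos _).le)]
    calc ∫ a in B, Real.exp (t * Y a - cgf Y μ t) ∂μ
        ≤ ∫ a in B, Real.exp (t * m + |t| * r - cgf Y μ t) ∂μ := by
          refine setIntegral_mono_on ?_ (integrable_const _).integrableOn hB fun ω hω ↦ ?_
          · simp_rw [Real.exp_sub]
            exact (ht.div_const _).integrableOn
          · gcongr
            have h1 : t * (Y ω - m) ≤ |t| * |Y ω - m| := (le_abs_self _).trans (abs_mul _ _).le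
            have h2 : |t| * |Y ω - m| ≤ |t| * r := by gcongr; exact le_of_lt hω
            linarith
      _ = _ := by rw [setIntegral_const, smul_eq_mul, mul_comm]
  calc _ ≤ Real.exp (cgf Y μ t - t * m - |t| * r) *
        (Real.exp (t * m + |t| * r - cgf Y μ t) * μ.real B) := by gcongr
    _ = μ.real B := by
      rw [← mul_assoc, ← Real.exp_add]
      ring_nf
      simp

/-- Lower bound for the probability of an interval around the mean of the tilted measure. -/
lemma half_exp_le_measureReal_abs_sub_lt {Ω : Type*} [MeasurableSpace Ω] {μ : Measure Ω}
    [IsProbabilityMeasure μ] {Y : Ω → ℝ} (hY : Measurable Y) {t : ℝ}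
    (ht : t ∈ interior (integrableExpSet Y μ)) {m r : ℝ} (hr : 0 < r)
    (hm : |deriv (cgf Y μ) t - m| ≤ r / 2) (hv : 8 * iteratedDeriv 2 (cgf Y μ) t ≤ r ^ 2) :
    Real.exp (cgf Y μ t - t * m - |t| * r) / 2 ≤ μ.real {ω | |Y ω - m| < r} := by
  have hint : Integrable (fun ω ↦ Real.exp (t * Y ω)) μ :=
    interior_subset (s := integrableExpSet Y μ) ht
  refine le_trans ?_ (exp_mul_tilted_abs_sub_lt_le hY hint m r)
  rw [div_eq_mul_inv]
  gcongr
  set Q := μ.tilted (t * Y ·)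
  have : IsProbabilityMeasure Q := isProbabilityMeasure_tilted hint
  have hB : MeasurableSet {ω | |Y ω - m| < r} := measurableSet_lt (by fun_prop) measurable_const
  have hc : Q.real {ω | |Y ω - m| < r}ᶜ ≤ 2⁻¹ := by
    have hsub : {ω | |Y ω - m| < r}ᶜ ⊆ {ω | r / 2 ≤ |Y ω - Q[Y]|} := by
      intro ω hω
      simp only [Set.mem_compl_iff, Set.mem_ofPred_eq, not_lt] at hω ⊢
      rw [integral_tilted_mul_self ht]
      have := abs_sub_le (Y ω) (deriv (cgf Y μ) t) m
      linarith
    have hcheb := meas_ge_le_variance_div_sq (memLp_tilted_mul ht 2) (half_pos hr)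
    rw [variance_tilted_mul ht] at hcheb
    refine ENNReal.toReal_le_of_le_ofReal (by norm_num) ((measure_mono hsub).trans ?_)
    refine hcheb.trans (ENNReal.ofReal_le_ofReal ?_)
    rw [div_le_iff₀ (by positivity)]
    linarith
  have := probReal_compl_eq_one_sub (μ := Q) hB
  linarith

lemma le_liminf_mul_log {ι : Type*} {l : Filter ι} [l.NeBot] {c E : ι → ℝ} {Q : ι → ENNReal}
    {x : ℝ} (hc : ∀ᶠ i in l, 0 ≤ c i) (hQ : ∀ᶠ i in l, ENNReal.ofReal (Real.exp (E i)) ≤ Q i)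
    (hx : Tendsto (fun i ↦ c i * E i) l (𝓝 x)) :
    (x : EReal) ≤ liminf (fun i ↦ (c i : EReal) * ENNReal.log (Q i)) l := by
  rw [← ((continuous_coe_real_ereal.tendsto x).comp hx).liminf_eq]
  refine liminf_le_liminf ?_
  filter_upwards [hc, hQ] with i hci hQi
  have h := ENNReal.log_le_log hQi
  rw [ENNReal.log_ofReal_of_pos (Real.exp_pos _), Real.log_exp] at h
  simp only [Function.comp, EReal.coe_mul]
  exact mul_le_mul_of_nonneg_left h (by exact_mod_cast hci)

lemma limsup_mul_log_le {ι : Type*} {l : Filter ι} [l.NeBot] {c E : ι → ℝ} {Q : ι → ENNReal}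
    {x : ℝ} (hc : ∀ᶠ i in l, 0 ≤ c i) (hQ : ∀ᶠ i in l, Q i ≤ ENNReal.ofReal (Real.exp (E i)))
    (hx : Tendsto (fun i ↦ c i * E i) l (𝓝 x)) :
    limsup (fun i ↦ (c i : EReal) * ENNReal.log (Q i)) l ≤ (x : EReal) := by
  rw [← ((continuous_coe_real_ereal.tendsto x).comp hx).limsup_eq]
  refine limsup_le_limsup ?_
  filter_upwards [hc, hQ] with i hci hQi
  have h := ENNReal.log_le_log hQi
  rw [ENNReal.log_ofReal_of_pos (Real.exp_pos _), Real.log_exp] at h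
  simp only [Function.comp, EReal.coe_mul]
  exact mul_le_mul_of_nonneg_left h (by exact_mod_cast hci)

lemma tendsto_const_mul_sqrt_nhdsNE {θ : ℝ} (hθ : θ ≠ 0) :
    Tendsto (fun q : ℝ ↦ θ * q ^ (1 / 2 : ℝ)) (𝓝[>] 0) (𝓝[≠] 0) := by
  refine tendsto_nhdsWithin_iff.2 ⟨?_, ?_⟩
  · have : ContinuousAt (fun q : ℝ ↦ θ * q ^ (1 / 2 : ℝ)) 0 :=
      continuousAt_const.mul (Real.continuousAt_rpow_const _ _ (Or.inr (by norm_num)))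
    have h := this.tendsto
    rw [Real.zero_rpow (by norm_num), mul_zero] at h
    exact h.mono_left nhdsWithin_le_nhds
  · filter_upwards [self_mem_nhdsWithin] with q hq
    exact mul_ne_zero hθ (Real.rpow_pos_of_pos hq _).ne'

lemma tendsto_natFloor_mul_rpow {c β : ℝ} (hc : 0 ≤ c) (hβ : 0 < β) :
    Tendsto (fun q : ℝ ↦ (⌊c * q ^ (-β)⌋₊ : ℝ) * q ^ β) (𝓝[>] 0) (𝓝 c) := by
  refine ((tendsto_nat_floor_mul_div_atTop hc).comp
    (tendsto_rpow_neg_nhdsGT_zero (neg_lt_zero.2 hβ))).congr' ?_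
  filter_upwards [self_mem_nhdsWithin] with q hq
  simp [Real.rpow_neg (le_of_lt hq)]

lemma tendsto_rpow_nhdsGT_zero {β : ℝ} (hβ : 0 < β) :
    Tendsto (fun q : ℝ ↦ q ^ β) (𝓝[>] 0) (𝓝 0) := by
  have := (Real.continuousAt_rpow_const (0 : ℝ) β (Or.inr hβ.le)).tendsto
  rw [Real.zero_rpow hβ.ne'] at this
  exact this.mono_left nhdsWithin_le_nhds

lemma tendsto_natFloor_add_one_mul_rpow {c β : ℝ} (hc : 0 ≤ c) (hβ : 0 < β) :
    Tendsto (fun q : ℝ ↦ ((⌊c * q ^ (-β)⌋₊ : ℝ) + 1) * q ^ β) (𝓝[>] 0) (𝓝 c) := by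
  simpa [add_mul] using (tendsto_natFloor_mul_rpow hc hβ).add (tendsto_rpow_nhdsGT_zero hβ)

lemma tendsto_log_one_sub_div :
    Tendsto (fun q : ℝ ↦ Real.log (1 - q) / q) (𝓝[>] 0) (𝓝 (-1)) := by
  have h : HasDerivAt (fun q : ℝ ↦ Real.log (1 - q)) (-1) 0 := by
    have := ((hasDerivAt_id (0 : ℝ)).const_sub 1).log (by simp)
    simpa using this
  refine ((hasDerivAt_iff_tendsto_slope.1 h).mono_left
    (nhdsWithin_mono _ fun q hq ↦ ne_of_gt hq)).congr fun q ↦ ?_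
  simp [slope_def_field]

section Exponents

variable {Λ : ℝ → ℝ} {c θ α : ℝ}

lemma tendsto_tilted_mean (hΛ : AnalyticAt ℝ Λ 0) (h1 : deriv Λ 0 = 0)
    (h2 : iteratedDeriv 2 Λ 0 = 1) (hc : 0 ≤ c) (hθ : θ ≠ 0) (hα : 0 < α) :
    Tendsto (fun q : ℝ ↦ q ^ (1 / 2 + α) * (((⌊c * q ^ (-(1 + α))⌋₊ : ℝ) + 1) *
      deriv Λ (θ * q ^ (1 / 2 : ℝ)))) (𝓝[>] 0) (𝓝 (c * θ)) := by
  have hd := (hΛ.tendsto_deriv_div h1).comp (tendsto_const_mul_sqrt_nhdsNE hθ)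
  have hk := tendsto_natFloor_add_one_mul_rpow hc (show 0 < 1 + α by linarith)
  have := (hk.mul hd).mul_const θ
  rw [h2, mul_one] at this
  refine this.congr' ?_
  filter_upwards [self_mem_nhdsWithin] with q (hq : 0 < q)
  have e : q ^ (1 + α) = q ^ (1 / 2 + α) * q ^ (1 / 2 : ℝ) := by
    rw [← Real.rpow_add hq]; ring_nf
  have : q ^ (1 / 2 : ℝ) ≠ 0 := (Real.rpow_pos_of_pos hq _).ne'
  simp only [Function.comp, e]
  field_simp

lemma tendsto_tilted_variance (hΛ : AnalyticAt ℝ Λ 0) (hc : 0 ≤ c) (hθ : θ ≠ 0) (hα : 0 < α) :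
    Tendsto (fun q : ℝ ↦ (q ^ (1 / 2 + α)) ^ 2 * (((⌊c * q ^ (-(1 + α))⌋₊ : ℝ) + 1) *
      iteratedDeriv 2 Λ (θ * q ^ (1 / 2 : ℝ)))) (𝓝[>] 0) (𝓝 0) := by
  have hd : Tendsto (iteratedDeriv 2 Λ) (𝓝[≠] 0) (𝓝 (iteratedDeriv 2 Λ 0)) := by
    rw [iteratedDeriv_succ, iteratedDeriv_one]
    exact hΛ.deriv.deriv.continuousAt.tendsto.mono_left nhdsWithin_le_nhds
  have hk := tendsto_natFloor_add_one_mul_rpow hc (show 0 < 1 + α by linarith)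
  have := ((tendsto_rpow_nhdsGT_zero hα).mul hk).mul
    (hd.comp (tendsto_const_mul_sqrt_nhdsNE hθ))
  rw [zero_mul, zero_mul] at this
  refine this.congr' ?_
  filter_upwards [self_mem_nhdsWithin] with q (hq : 0 < q)
  have e : (q ^ (1 / 2 + α)) ^ 2 = q ^ α * q ^ (1 + α) := by
    rw [← Real.rpow_natCast, ← Real.rpow_mul hq.le, ← Real.rpow_add hq]
    push_cast; ring_nf
  simp only [Function.comp, e]
  ring

lemma tendsto_tilted_cgf (hΛ : AnalyticAt ℝ Λ 0) (h0 : Λ 0 = 0) (h1 : deriv Λ 0 = 0)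
    (h2 : iteratedDeriv 2 Λ 0 = 1) (hc : 0 ≤ c) (hθ : θ ≠ 0) (hα : 0 < α) :
    Tendsto (fun q : ℝ ↦ q ^ α * (((⌊c * q ^ (-(1 + α))⌋₊ : ℝ) + 1) *
      Λ (θ * q ^ (1 / 2 : ℝ)))) (𝓝[>] 0) (𝓝 (c * θ ^ 2 / 2)) := by
  have hd := (hΛ.tendsto_div_sq h0 h1).comp (tendsto_const_mul_sqrt_nhdsNE hθ)
  have hk := tendsto_natFloor_add_one_mul_rpow hc (show 0 < 1 + α by linarith)
  have := (hk.mul hd).mul_const (θ ^ 2)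
  rw [h2, mul_one_div, div_mul_eq_mul_div] at this
  refine this.congr' ?_
  filter_upwards [self_mem_nhdsWithin] with q (hq : 0 < q)
  have e : q ^ (1 + α) = q ^ α * (q ^ (1 / 2 : ℝ)) ^ 2 := by
    rw [← Real.rpow_natCast, ← Real.rpow_mul hq.le, ← Real.rpow_add hq]
    push_cast; ring_nf
  have : q ^ (1 / 2 : ℝ) ≠ 0 := (Real.rpow_pos_of_pos hq _).ne'
  simp only [Function.comp, e]
  field_simp

lemma tendsto_rpow_mul_floor_mul_log (hc : 0 ≤ c) (hα : 0 < α) :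
    Tendsto (fun q : ℝ ↦ q ^ α * ((⌊c * q ^ (-(1 + α))⌋₊ : ℝ) * Real.log (1 - q)))
      (𝓝[>] 0) (𝓝 (-c)) := by
  have := (tendsto_natFloor_mul_rpow hc (show 0 < 1 + α by linarith)).mul tendsto_log_one_sub_div
  rw [mul_neg_one] at this
  refine this.congr' ?_
  filter_upwards [self_mem_nhdsWithin] with q (hq : 0 < q)
  rw [Real.rpow_add hq, Real.rpow_one]
  field_simp

lemma tendsto_rpow_mul_log (hα : 0 < α) :
    Tendsto (fun q : ℝ ↦ q ^ α * Real.log q) (𝓝[>] 0) (𝓝 0) :=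
  (tendsto_log_mul_rpow_nhdsGT_zero hα).congr fun _ ↦ mul_comm _ _

end Exponents

/-- The geometric mixture of the powers of `M (θ √q)` stays bounded as long as `θ ^ 2 < 2`. -/
lemma eventually_geometric_ratio_le {M : ℝ → ℝ} (hM : AnalyticAt ℝ M 0) (h0 : M 0 = 1)
    (h1 : deriv M 0 = 0) (h2 : iteratedDeriv 2 M 0 = 1) {θ : ℝ} (hθ : θ ≠ 0) (hθ2 : θ ^ 2 < 2) :
    ∀ᶠ q : ℝ in 𝓝[>] 0, M (θ * q ^ (1 / 2 : ℝ)) ≤ 2 ∧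
      (1 - q) * M (θ * q ^ (1 / 2 : ℝ)) ≤ 1 - (1 - θ ^ 2 / 2) / 2 * q := by
  have hs := tendsto_const_mul_sqrt_nhdsNE hθ
  have hM1 : Tendsto (fun q : ℝ ↦ M (θ * q ^ (1 / 2 : ℝ))) (𝓝[>] 0) (𝓝 1) := by
    have := hM.continuousAt.tendsto.comp (hs.mono_right nhdsWithin_le_nhds)
    rwa [h0] at this
  have hsq : Tendsto (fun q : ℝ ↦ (M (θ * q ^ (1 / 2 : ℝ)) - 1) / q) (𝓝[>] 0) (𝓝 (θ ^ 2 / 2)) := by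
    have h := (AnalyticAt.tendsto_div_sq (f := fun t ↦ M t - 1) (by fun_prop) (by simp [h0])
      (by simp [h1])).comp hs
    have h2' : iteratedDeriv 2 (fun t ↦ M t - 1) 0 = 1 := by
      rw [← h2, iteratedDeriv_succ, iteratedDeriv_one, iteratedDeriv_succ, iteratedDeriv_one]
      congr 1
      ext t
      simp
    have := h.mul_const (θ ^ 2)
    rw [h2', div_mul_eq_mul_div, one_mul] at this
    refine this.congr' ?_
    filter_upwards [self_mem_nhdsWithin] with q (hq : 0 < q)
    have e : (q ^ (1 / 2 : ℝ)) ^ 2 = q := by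
      rw [← Real.rpow_natCast, ← Real.rpow_mul hq.le]
      norm_num
    simp only [Function.comp, mul_pow, e]
    field_simp
  have hlim := hsq.sub hM1
  filter_upwards [self_mem_nhdsWithin, hM1.eventually (eventually_le_nhds one_lt_two),
    hlim.eventually (eventually_le_nhds (show θ ^ 2 / 2 - 1 < -((1 - θ ^ 2 / 2) / 2) by linarith))]
    with q (hq : 0 < q) h2 h3
  refine ⟨h2, ?_⟩
  have := mul_le_mul_of_nonneg_right h3 hq.le
  rw [sub_mul, div_mul_cancel₀ _ hq.ne'] at this
  linarith

section RandomWalk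

variable {Ω : Type*} [MeasurableSpace Ω] {P : Measure Ω} {X : ℕ → Ω → ℝ}
  {N : Ω → ℕ} {p : unitInterval}

lemma mgf_sum_range (hX_meas : ∀ i, Measurable (X i)) (hX_indep : iIndepFun X P)
    (hX_ident : ∀ i, IdentDistrib (X i) (X 0) P P) (k : ℕ) (t : ℝ) :
    mgf (fun ω ↦ ∑ i ∈ Finset.range k, X i ω) P t = mgf (X 0) P t ^ k := by
  have h := hX_indep.mgf_sum hX_meas (Finset.range k) (t := t)
  rw [Finset.prod_congr rfl fun i _ ↦ mgf_congr_of_identDistrib _ _ (hX_ident i) t] at h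
  simpa [Finset.sum_fn] using h

lemma shiftedGeometric_singleton_succ (hp : 0 < p) (n : ℕ) :
    shiftedGeometric p {n + 1} = ENNReal.ofReal ((1 - p) ^ n * p) := by
  rw [shiftedGeometric, Measure.map_apply (by fun_prop) (measurableSet_singleton _),
    ← geometricMeasure_singleton hp.ne']
  congr 1
  ext m
  simp

lemma shiftedGeometric_singleton_zero : shiftedGeometric p {0} = 0 := by
  rw [shiftedGeometric, Measure.map_apply (by fun_prop) (measurableSet_singleton _)]
  have : (fun n : ℕ ↦ n + 1) ⁻¹' {0} = ∅ := by
    ext m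
    simp
  rw [this, measure_empty]

lemma measure_eq_inter_sum_range_mem
    (hN_law : HasLaw N (shiftedGeometric p) P) (hp : 0 < p)
    (hN_indep : IndepFun (fun ω i ↦ X i ω) N P) (n : ℕ) {B : Set ℝ} (hB : MeasurableSet B) :
    P {ω | N ω = n + 1 ∧ ∑ i ∈ Finset.range (n + 1), X i ω ∈ B} =
      ENNReal.ofReal ((1 - p) ^ n * p) * P {ω | ∑ i ∈ Finset.range (n + 1), X i ω ∈ B} := by
  have hS : MeasurableSet {x : ℕ → ℝ | ∑ i ∈ Finset.range (n + 1), x i ∈ B} :=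
    (show Measurable fun x : ℕ → ℝ ↦ ∑ i ∈ Finset.range (n + 1), x i by fun_prop) hB
  have h := hN_indep.measure_inter_preimage_eq_mul _ _ hS (measurableSet_singleton (n + 1))
  have hN : P (N ⁻¹' {n + 1}) = ENNReal.ofReal ((1 - p) ^ n * p) := by
    rw [← shiftedGeometric_singleton_succ hp, ← hN_law.map_eq,
      Measure.map_apply_of_aemeasurable hN_law.aemeasurable (measurableSet_singleton _)]
  rw [hN, mul_comm] at h
  convert! h using 2
  ext ω
  simp [and_comm]

lemma cgf_sum_range (hX_meas : ∀ i, Measurable (X i)) (hX_indep : iIndepFun X P)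
    (hX_ident : ∀ i, IdentDistrib (X i) (X 0) P P) (k : ℕ) :
    cgf (fun ω ↦ ∑ i ∈ Finset.range k, X i ω) P = fun t ↦ k * cgf (X 0) P t := by
  ext t
  rw [cgf, mgf_sum_range hX_meas hX_indep hX_ident, Real.log_pow, cgf]

variable [IsProbabilityMeasure P]

lemma integrableExpSet_subset_sum_range (hX_meas : ∀ i, Measurable (X i))
    (hX_indep : iIndepFun X P) (hX_ident : ∀ i, IdentDistrib (X i) (X 0) P P) (k : ℕ) :
    integrableExpSet (X 0) P ⊆ integrableExpSet (fun ω ↦ ∑ i ∈ Finset.range k, X i ω) P := by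
  intro t ht
  have h := hX_indep.integrable_exp_mul_sum (t := t) (s := Finset.range k) hX_meas fun i _ ↦ by
    have := (hX_ident i).comp (u := fun x ↦ Real.exp (t * x)) (by fun_prop)
    exact this.integrable_iff.2 ht
  simpa [Finset.sum_fn, integrableExpSet] using h

lemma measureReal_le_abs_le (Y : Ω → ℝ) {t : ℝ} (ht0 : 0 ≤ t) (ht : t ∈ integrableExpSet Y P)
    (ht' : -t ∈ integrableExpSet Y P) (b : ℝ) :
    P.real {ω | b ≤ |Y ω|} ≤ Real.exp (-t * b) * (mgf Y P t + mgf Y P (-t)) := by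
  have h1 := measure_ge_le_exp_mul_mgf b ht0 ht
  have h2 := measure_le_le_exp_mul_mgf (-b) (neg_nonpos.2 ht0) ht'
  have hsub : {ω | b ≤ |Y ω|} ⊆ {ω | b ≤ Y ω} ∪ {ω | Y ω ≤ -b} := fun ω hω ↦ by
    rcases le_abs.1 (show b ≤ |Y ω| from hω) with h | h
    · exact Or.inl h
    · exact Or.inr (le_neg_of_le_neg h)
  refine (measureReal_mono hsub).trans ((measureReal_union_le _ _).trans ?_)
  rw [neg_neg, mul_neg, ← neg_mul] at h2
  linarith

/-- Exponential bound for the two-sided tail of a geometric random sum. -/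
lemma measure_le_abs_randomSum_le (hX_meas : ∀ i, Measurable (X i)) (hX_indep : iIndepFun X P)
    (hX_ident : ∀ i, IdentDistrib (X i) (X 0) P P)
    (hN_law : HasLaw N (shiftedGeometric p) P) (hp : 0 < p)
    (hN_indep : IndepFun (fun ω i ↦ X i ω) N P) {t δ : ℝ} (ht0 : 0 ≤ t) (hδ : 0 < δ)
    (ht : t ∈ integrableExpSet (X 0) P) (ht' : -t ∈ integrableExpSet (X 0) P)
    (hM : ∀ u ∈ ({t, -t} : Set ℝ), mgf (X 0) P u ≤ 2 ∧ (1 - p) * mgf (X 0) P u ≤ 1 - δ * p)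
    (b : ℝ) :
    P {ω | b ≤ |∑ i ∈ Finset.range (N ω), X i ω|} ≤
      ENNReal.ofReal (Real.exp (-t * b) * (4 / δ)) := by
  have hp' : (0 : ℝ) < p := hp
  have hp1 : (0 : ℝ) ≤ 1 - p := sub_nonneg.2 p.2.2
  set f : ℝ → ℕ → ℝ := fun u n ↦ mgf (X 0) P u * p * ((1 - p) * mgf (X 0) P u) ^ n
  have hf0 : ∀ u n, 0 ≤ f u n := fun u n ↦
    mul_nonneg (mul_nonneg mgf_nonneg hp'.le) (pow_nonneg (mul_nonneg hp1 mgf_nonneg) n)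
  have hf : ∀ u ∈ ({t, -t} : Set ℝ), Summable (f u) ∧ ∑' n, f u n ≤ 2 / δ := by
    intro u hu
    obtain ⟨h2, h3⟩ := hM u hu
    have hr0 : 0 ≤ (1 - p) * mgf (X 0) P u := mul_nonneg hp1 mgf_nonneg
    have hδp : 0 < δ * p := mul_pos hδ hp'
    have hs := hasSum_geometric_of_lt_one hr0 (by linarith)
    refine ⟨hs.summable.mul_left _, ?_⟩
    rw [(hs.mul_left _).tsum_eq, ← div_eq_mul_inv]
    calc mgf (X 0) P u * p / (1 - (1 - p) * mgf (X 0) P u) ≤ 2 * p / (δ * p) := by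
          gcongr
          linarith
      _ = 2 / δ := by field_simp
  have hsub : {ω | b ≤ |∑ i ∈ Finset.range (N ω), X i ω|} ⊆ N ⁻¹' {0} ∪
      ⋃ n : ℕ, {ω | N ω = n + 1 ∧ ∑ i ∈ Finset.range (n + 1), X i ω ∈ {x : ℝ | b ≤ |x|}} := by
    intro ω hω
    rcases Nat.eq_zero_or_eq_succ_pred (N ω) with h | h
    · exact Or.inl h
    · refine Or.inr (Set.mem_iUnion.2 ⟨(N ω).pred, h, ?_⟩)
      rw [← Nat.succ_eq_add_one, ← h]
      exact hω
  have hN0 : P (N ⁻¹' {0}) = 0 := by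
    rw [← shiftedGeometric_singleton_zero (p := p), ← hN_law.map_eq,
      Measure.map_apply_of_aemeasurable hN_law.aemeasurable (measurableSet_singleton _)]
  have hB : MeasurableSet {x : ℝ | b ≤ |x|} := measurableSet_le measurable_const (by fun_prop)
  have hterm : ∀ n : ℕ,
      P {ω | N ω = n + 1 ∧ ∑ i ∈ Finset.range (n + 1), X i ω ∈ {x : ℝ | b ≤ |x|}} ≤
        ENNReal.ofReal (Real.exp (-t * b) * (f t n + f (-t) n)) := by
    intro n
    have hI := integrableExpSet_subset_sum_range hX_meas hX_indep hX_ident (n + 1)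
    have h := measureReal_le_abs_le (P := P) (fun ω ↦ ∑ i ∈ Finset.range (n + 1), X i ω) ht0
      (hI ht) (hI ht') b
    rw [mgf_sum_range hX_meas hX_indep hX_ident, mgf_sum_range hX_meas hX_indep hX_ident] at h
    rw [measure_eq_inter_sum_range_mem hN_law hp hN_indep n hB]
    simp only [Set.mem_ofPred_eq]
    rw [← ofReal_measureReal, ← ENNReal.ofReal_mul (geometricMeasure_nonneg p n)]
    refine ENNReal.ofReal_le_ofReal ((mul_le_mul_of_nonneg_left h
      (geometricMeasure_nonneg p n)).trans_eq ?_)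
    simp only [f, mul_pow, pow_succ]
    ring
  have hadd := ((hf t (by simp)).1.add (hf (-t) (by simp)).1).mul_left (Real.exp (-t * b))
  calc P {ω | b ≤ |∑ i ∈ Finset.range (N ω), X i ω|}
      ≤ ∑' n : ℕ, P {ω | N ω = n + 1 ∧
          ∑ i ∈ Finset.range (n + 1), X i ω ∈ {x : ℝ | b ≤ |x|}} := by
        refine (measure_mono hsub).trans ((measure_union_le _ _).trans ?_)
        rw [hN0, zero_add]
        exact measure_iUnion_le _
    _ ≤ ∑' n, ENNReal.ofReal (Real.exp (-t * b) * (f t n + f (-t) n)) := ENNReal.tsum_le_tsum hterm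
    _ = ENNReal.ofReal (∑' n, Real.exp (-t * b) * (f t n + f (-t) n)) :=
        (ENNReal.ofReal_tsum_of_nonneg (fun n ↦ mul_nonneg (Real.exp_pos _).le
          (add_nonneg (hf0 _ _) (hf0 _ _))) hadd).symm
    _ ≤ _ := by
        refine ENNReal.ofReal_le_ofReal ?_
        rw [tsum_mul_left, (hf t (by simp)).1.tsum_add (hf (-t) (by simp)).1]
        gcongr
        calc _ ≤ 2 / δ + 2 / δ := add_le_add (hf t (by simp)).2 (hf (-t) (by simp)).2
          _ = 4 / δ := by ring

/-- Lower bound for the probability of an interval, from a single value of the random index. -/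
lemma le_measure_abs_randomSum_sub_lt (hX_meas : ∀ i, Measurable (X i))
    (hX_indep : iIndepFun X P) (hX_ident : ∀ i, IdentDistrib (X i) (X 0) P P)
    (hN_law : HasLaw N (shiftedGeometric p) P) (hp : 0 < p) (hp1 : p < 1)
    (hN_indep : IndepFun (fun ω i ↦ X i ω) N P) {t m r : ℝ} (n : ℕ)
    (ht : t ∈ interior (integrableExpSet (X 0) P)) (hr : 0 < r)
    (hm : |(n + 1) * deriv (cgf (X 0) P) t - m| ≤ r / 2)
    (hv : 8 * ((n + 1) * iteratedDeriv 2 (cgf (X 0) P) t) ≤ r ^ 2) :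
    ENNReal.ofReal (Real.exp ((n + 1) * cgf (X 0) P t - t * m - |t| * r +
      n * Real.log (1 - p) + Real.log p - Real.log 2)) ≤
      P {ω | |∑ i ∈ Finset.range (N ω), X i ω - m| < r} := by
  have hp' : (0 : ℝ) < p := hp
  have hp1' : (0 : ℝ) < 1 - p := sub_pos.2 (show (p : ℝ) < 1 from hp1)
  have hc := cgf_sum_range hX_meas hX_indep hX_ident (n + 1)
  have hd2 : iteratedDeriv 2 (fun t ↦ ((n + 1 : ℕ) : ℝ) * cgf (X 0) P t) t =
      (n + 1) * iteratedDeriv 2 (cgf (X 0) P) t := by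
    have : deriv (fun t ↦ ((n + 1 : ℕ) : ℝ) * cgf (X 0) P t) =
        fun t ↦ ((n + 1 : ℕ) : ℝ) * deriv (cgf (X 0) P) t :=
      funext fun _ ↦ deriv_const_mul_field _
    rw [iteratedDeriv_succ, iteratedDeriv_one, this, deriv_const_mul_field, iteratedDeriv_succ,
      iteratedDeriv_one]
    push_cast
    rfl
  have h := half_exp_le_measureReal_abs_sub_lt (μ := P)
    (Y := fun ω ↦ ∑ i ∈ Finset.range (n + 1), X i ω) (by fun_prop)
    (interior_mono (integrableExpSet_subset_sum_range hX_meas hX_indep hX_ident (n + 1)) ht)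
    (m := m) hr (by rw [hc, deriv_const_mul_field]; exact_mod_cast hm) (by rwa [hc, hd2])
  have hB : MeasurableSet {x : ℝ | |x - m| < r} := measurableSet_lt (by fun_prop) measurable_const
  have heq := measure_eq_inter_sum_range_mem hN_law hp hN_indep n hB
  calc _ = ENNReal.ofReal (((1 - p) ^ n * p) * (Real.exp (cgf (fun ω ↦
        ∑ i ∈ Finset.range (n + 1), X i ω) P t - t * m - |t| * r) / 2)) := by
        rw [hc, Real.exp_sub, Real.exp_add, Real.exp_add, Real.exp_log hp', Real.exp_log two_pos,
          Real.exp_nat_mul, Real.exp_log hp1']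
        push_cast
        congr 1
        ring
    _ ≤ ENNReal.ofReal (((1 - p) ^ n * p) *
        P.real {ω | |∑ i ∈ Finset.range (n + 1), X i ω - m| < r}) := by gcongr
    _ = P {ω | N ω = n + 1 ∧ ∑ i ∈ Finset.range (n + 1), X i ω ∈ {x : ℝ | |x - m| < r}} := by
        rw [heq, ENNReal.ofReal_mul (by positivity), ofReal_measureReal]
        rfl
    _ ≤ _ := measure_mono fun ω hω ↦ by
        obtain ⟨h1, h2⟩ := hω
        simp only [Set.mem_ofPred_eq] at h2 ⊢
        rwa [h1]

end RandomWalk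

lemma unitInterval.tendsto_coe_nhdsGT_zero :
    Tendsto (fun p : unitInterval ↦ (p : ℝ)) (𝓝[>] 0) (𝓝[>] 0) :=
  tendsto_nhdsWithin_iff.2 ⟨(continuous_subtype_val.tendsto (0 : unitInterval)).mono_left
    nhdsWithin_le_nhds, self_mem_nhdsWithin⟩

instance unitInterval.nhdsGT_zero_neBot : (𝓝[>] (0 : unitInterval)).NeBot :=
  nhdsGT_neBot_of_exists_gt ⟨1, zero_lt_one⟩

section Cumulants

variable {Ω : Type*} [MeasurableSpace Ω] {P : Measure Ω} {Y : Ω → ℝ}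

lemma iteratedDeriv_two_mgf_zero (h0 : 0 ∈ interior (integrableExpSet Y P))
    (hmean : ∫ ω, Y ω ∂P = 0) (hvar : variance Y P = 1) : iteratedDeriv 2 (mgf Y P) 0 = 1 := by
  rw [iteratedDeriv_mgf_zero h0, ← hvar, variance_of_integral_eq_zero
    (aemeasurable_of_mem_interior_integrableExpSet h0) hmean]
  rfl

lemma iteratedDeriv_two_cgf_zero [IsProbabilityMeasure P]
    (h0 : 0 ∈ interior (integrableExpSet Y P))
    (hvar : variance Y P = 1) : iteratedDeriv 2 (cgf Y P) 0 = 1 := by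
  rw [← variance_tilted_mul h0]
  simpa using hvar

end Cumulants

section ModerateDeviations

variable {Ω : Type*} [MeasurableSpace Ω] {P : Measure Ω} [IsProbabilityMeasure P] {X : ℕ → Ω → ℝ}
  {ν : unitInterval → Ω → ℕ} {α : ℝ}

/-- Upper bound for the two-sided tails, for each rate below the critical one. -/
lemma limsup_log_measure_le_abs_le (hX_meas : ∀ i, Measurable (X i)) (hX_indep : iIndepFun X P)
    (hX_ident : ∀ i, IdentDistrib (X i) (X 0) P P) (hX_mean : ∫ ω, X 0 ω ∂P = 0)
    (hX_var : variance (X 0) P = 1) (h0 : 0 ∈ interior (integrableExpSet (X 0) P))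
    (hν_law : ∀ p : unitInterval, 0 < p → HasLaw (ν p) (shiftedGeometric p) P)
    (hν_indep : ∀ p : unitInterval, 0 < p → IndepFun (fun ω i ↦ X i ω) (ν p) P)
    (hα : 0 < α) {θ : ℝ} (hθ : 0 < θ) (hθ2 : θ ^ 2 < 2) (a : ℝ) :
    limsup (fun p : unitInterval ↦ ((1 / (p : ℝ) ^ (-α) : ℝ) : EReal) *
      ENNReal.log (P {ω | a ≤ |rescaledRandomSum X (ν p) p α ω|})) (𝓝[>] 0) ≤
      ((-(θ * a) : ℝ) : EReal) := by
  set δ : ℝ := (1 - θ ^ 2 / 2) / 2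
  have hδ : 0 < δ := by simp only [δ]; linarith
  have hT := unitInterval.tendsto_coe_nhdsGT_zero
  have hM := analyticAt_mgf h0
  have hM1 : deriv (mgf (X 0) P) 0 = 0 := by rw [deriv_mgf_zero h0, hX_mean]
  have hM2 := iteratedDeriv_two_mgf_zero h0 hX_mean hX_var
  have hpos := eventually_geometric_ratio_le hM mgf_zero hM1 hM2 hθ.ne' hθ2
  have hneg := eventually_geometric_ratio_le hM mgf_zero hM1 hM2 (neg_ne_zero.2 hθ.ne')
    (by rwa [neg_sq])
  have hint : ∀ ϑ : ℝ, ϑ ≠ 0 → ∀ᶠ q : ℝ in 𝓝[>] 0,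
      ϑ * q ^ (1 / 2 : ℝ) ∈ integrableExpSet (X 0) P := fun ϑ hϑ ↦
    ((tendsto_const_mul_sqrt_nhdsNE hϑ).mono_right nhdsWithin_le_nhds).eventually
      (mem_interior_iff_mem_nhds.1 h0)
  refine limsup_mul_log_le (E := fun p : unitInterval ↦
    Real.log (4 / δ) - θ * (p : ℝ) ^ (-α) * a) ?_ ?_ ?_
  · exact .of_forall fun p ↦ one_div_nonneg.2 (Real.rpow_nonneg p.2.1 _)
  · filter_upwards [self_mem_nhdsWithin, hT.eventually hpos, hT.eventually hneg,
      hT.eventually (hint θ hθ.ne'), hT.eventually (hint (-θ) (neg_ne_zero.2 hθ.ne'))]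
      with p hp h1 h2 h3 h4
    have hp' : (0 : ℝ) < p := hp
    rw [neg_sq] at h2
    rw [neg_mul] at h2 h4
    have hsc : (0 : ℝ) < (p : ℝ) ^ (1 / 2 + α) := Real.rpow_pos_of_pos hp' _
    have hbd := measure_le_abs_randomSum_le hX_meas hX_indep hX_ident (hν_law p hp) hp
      (hν_indep p hp) (t := θ * (p : ℝ) ^ (1 / 2 : ℝ)) (by positivity) hδ h3 h4 (by
        rintro u (rfl | rfl)
        exacts [h1, h2]) (a / (p : ℝ) ^ (1 / 2 + α))
    convert! hbd using 1
    · congr 1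
      ext ω
      simp only [Set.mem_ofPred_eq, rescaledRandomSum]
      rw [abs_mul, abs_of_pos hsc, div_le_iff₀ hsc, mul_comm]
    · congr 1
      have e : (p : ℝ) ^ (1 / 2 : ℝ) / (p : ℝ) ^ (1 / 2 + α) = (p : ℝ) ^ (-α) := by
        rw [← Real.rpow_sub hp']; ring_nf
      rw [Real.exp_sub, Real.exp_log (by positivity), ← e, div_eq_mul_inv, ← Real.exp_neg, mul_comm]
      congr 2
      ring
  · have h := ((tendsto_rpow_nhdsGT_zero hα).mul_const (Real.log (4 / δ))).sub_const (θ * a)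
    rw [zero_mul, zero_sub] at h
    refine (h.comp hT).congr' ?_
    filter_upwards [self_mem_nhdsWithin] with p hp
    have hp' : (0 : ℝ) < p := hp
    have hpα := Real.rpow_pos_of_pos hp' α
    simp only [Function.comp, Real.rpow_neg hp'.le]
    field_simp

/-- Lower bound for the probability that the rescaled random sum is close to `c * θ`, in the
optimal case `θ ^ 2 = 2`. -/
lemma le_liminf_log_measure_abs_sub_lt (hX_meas : ∀ i, Measurable (X i))
    (hX_indep : iIndepFun X P) (hX_ident : ∀ i, IdentDistrib (X i) (X 0) P P)
    (hX_mean : ∫ ω, X 0 ω ∂P = 0) (hX_var : variance (X 0) P = 1)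
    (h0 : 0 ∈ interior (integrableExpSet (X 0) P))
    (hν_law : ∀ p : unitInterval, 0 < p → HasLaw (ν p) (shiftedGeometric p) P)
    (hν_indep : ∀ p : unitInterval, 0 < p → IndepFun (fun ω i ↦ X i ω) (ν p) P)
    (hα : 0 < α) {c θ ε : ℝ} (hc : 0 ≤ c) (hθ : θ ^ 2 = 2) (hε : 0 < ε) :
    ((-(2 * c) - |θ| * ε : ℝ) : EReal) ≤
      liminf (fun p : unitInterval ↦ ((1 / (p : ℝ) ^ (-α) : ℝ) : EReal) *
        ENNReal.log (P {ω | |rescaledRandomSum X (ν p) p α ω - c * θ| < ε})) (𝓝[>] 0) := by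
  have hθ0 : θ ≠ 0 := by rintro rfl; norm_num at hθ
  have hT := unitInterval.tendsto_coe_nhdsGT_zero
  have hΛ := analyticAt_cgf h0
  have hΛ1 : deriv (cgf (X 0) P) 0 = 0 := by rw [deriv_cgf_zero h0, hX_mean, zero_div]
  have hΛ2 := iteratedDeriv_two_cgf_zero h0 hX_var
  have hmean := tendsto_tilted_mean hΛ hΛ1 hΛ2 hc hθ0 hα
  have hvar := tendsto_tilted_variance hΛ hc hθ0 hα
  have hcgf := tendsto_tilted_cgf hΛ cgf_zero hΛ1 hΛ2 hc hθ0 hα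
  have hint : ∀ᶠ q : ℝ in 𝓝[>] 0, θ * q ^ (1 / 2 : ℝ) ∈ interior (integrableExpSet (X 0) P) :=
    ((tendsto_const_mul_sqrt_nhdsNE hθ0).mono_right nhdsWithin_le_nhds).eventually
      (isOpen_interior.mem_nhds h0)
  have hmean' := hmean.eventually (Metric.closedBall_mem_nhds _ (half_pos hε))
  have hvar' := hvar.eventually (eventually_le_nhds (show 0 < ε ^ 2 / 8 by positivity))
  have hlt : ∀ᶠ q : ℝ in 𝓝[>] 0, q < 1 :=
    (eventually_lt_nhds zero_lt_one).filter_mono nhdsWithin_le_nhds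
  refine le_liminf_mul_log (E := fun p : unitInterval ↦
    ((⌊c * (p : ℝ) ^ (-(1 + α))⌋₊ : ℝ) + 1) * cgf (X 0) P (θ * (p : ℝ) ^ (1 / 2 : ℝ)) -
      θ * (p : ℝ) ^ (1 / 2 : ℝ) * (c * θ / (p : ℝ) ^ (1 / 2 + α)) -
      |θ * (p : ℝ) ^ (1 / 2 : ℝ)| * (ε / (p : ℝ) ^ (1 / 2 + α)) +
      (⌊c * (p : ℝ) ^ (-(1 + α))⌋₊ : ℝ) * Real.log (1 - p) + Real.log p - Real.log 2) ?_ ?_ ?_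
  · exact .of_forall fun p ↦ one_div_nonneg.2 (Real.rpow_nonneg p.2.1 _)
  · filter_upwards [self_mem_nhdsWithin, hT.eventually hint, hT.eventually hmean',
      hT.eventually hvar', hT.eventually hlt] with p hp h1 h2 h3 h4
    have hp' : (0 : ℝ) < p := hp
    have hsc : (0 : ℝ) < (p : ℝ) ^ (1 / 2 + α) := Real.rpow_pos_of_pos hp' _
    refine (le_measure_abs_randomSum_sub_lt hX_meas hX_indep hX_ident (hν_law p hp) hp h4
      (hν_indep p hp) _ h1 (div_pos hε hsc) (m := c * θ / (p : ℝ) ^ (1 / 2 + α)) ?_ ?_).trans_eq ?_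
    · refine le_of_mul_le_mul_left ?_ hsc
      rw [Real.dist_eq] at h2
      rw [← abs_of_pos hsc, ← abs_mul, abs_of_pos hsc, mul_sub, mul_div_cancel₀ _ hsc.ne']
      refine h2.trans_eq ?_
      field_simp
    · rw [div_pow, le_div_iff₀ (by positivity)]
      linarith
    · congr 1
      ext ω
      simp only [Set.mem_ofPred_eq, rescaledRandomSum]
      rw [lt_div_iff₀ hsc, ← abs_of_pos hsc, ← abs_mul, abs_of_pos hsc, sub_mul,
        div_mul_cancel₀ _ hsc.ne', mul_comm]
  · have h := ((((hcgf.sub_const (c * θ ^ 2)).sub_const (|θ| * ε)).add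
      (tendsto_rpow_mul_floor_mul_log hc hα)).add (tendsto_rpow_mul_log hα)).sub
      ((tendsto_rpow_nhdsGT_zero hα).mul_const (Real.log 2))
    have e : c * θ ^ 2 / 2 - c * θ ^ 2 - |θ| * ε + -c + 0 - 0 * Real.log 2 =
        -(2 * c) - |θ| * ε := by rw [hθ]; ring
    rw [e] at h
    refine (h.comp hT).congr' ?_
    filter_upwards [self_mem_nhdsWithin] with p hp
    have hp' : (0 : ℝ) < p := hp
    have hpα := Real.rpow_pos_of_pos hp' α
    have hph := Real.rpow_pos_of_pos hp' (1 / 2)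
    simp only [Function.comp, Real.rpow_neg hp'.le α, Real.rpow_add hp' (1 / 2) α, abs_mul,
      abs_of_pos hph]
    field_simp

end ModerateDeviations

theorem mainTheorem5 {Ω : Type*} [MeasurableSpace Ω] (P : Measure Ω) [IsProbabilityMeasure P]
    (X : ℕ → Ω → ℝ)
    (hX_meas : ∀ i, Measurable (X i))
    (hX_indep : iIndepFun X P)
    (hX_ident : ∀ i, IdentDistrib (X i) (X 0) P P)
    (hX_mean : ∫ ω, X 0 ω ∂P = 0)
    (hX_var : variance (X 0) P = 1)
    (hX_mgf : ∃ D : ℝ, 0 < D ∧ ∀ t ∈ Set.Ioo (-D) D, Integrable (fun ω ↦ Real.exp (t * X 0 ω)) P)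
    (ν : unitInterval → Ω → ℕ)
    (hν_meas : ∀ p : unitInterval, 0 < p → Measurable (ν p))
    (hν_law : ∀ p : unitInterval, 0 < p → HasLaw (ν p) (shiftedGeometric p) P)
    (hν_indep : ∀ p : unitInterval, 0 < p → IndepFun (fun ω i ↦ X i ω) (ν p) P)
    (α : ℝ) (hα_pos : 0 < α) (hα_lt : α < 1 / 2) :
    SatisfiesLDP (𝓝[>] (0 : unitInterval)) P
      (fun p ↦ rescaledRandomSum X (ν p) (p : ℝ) α)
      (fun p ↦ (p : ℝ) ^ (-α))
      (fun y ↦ Real.sqrt 2 * |y|) := by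
  have h0 : 0 ∈ interior (integrableExpSet (X 0) P) := by
    obtain ⟨D, hD, hint⟩ := hX_mgf
    exact mem_interior.2 ⟨Set.Ioo (-D) D, hint, isOpen_Ioo, neg_lt_zero.2 hD, hD⟩
  have hs2 : (0 : ℝ) < Real.sqrt 2 := by positivity
  have hss : Real.sqrt 2 ^ 2 = 2 := Real.sq_sqrt zero_le_two
  refine ⟨?_, fun x ↦ by positivity, fun L _ ↦ ?_, fun G hG ↦ ?_, fun A hA ↦ ?_⟩
  · exact (tendsto_rpow_neg_nhdsGT_zero (neg_lt_zero.2 hα_pos)).comp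
      unitInterval.tendsto_coe_nhdsGT_zero
  · have : {x : ℝ | Real.sqrt 2 * |x| ≤ L} = Metric.closedBall 0 (L / Real.sqrt 2) := by
      ext x
      rw [Set.mem_ofPred_eq, mem_closedBall_zero_iff, Real.norm_eq_abs, le_div_iff₀ hs2, mul_comm]
    rw [this]
    exact isCompact_closedBall _ _
  · rw [EReal.neg_le]
    refine le_iInf₂ fun y hy ↦ ?_
    rw [EReal.neg_le, ← EReal.coe_neg]
    obtain ⟨r, hr, hrG⟩ := Metric.isOpen_iff.1 hG y hy
    obtain ⟨θ, hθ, hcθ⟩ : ∃ θ : ℝ, |θ| = Real.sqrt 2 ∧ |y| / Real.sqrt 2 * θ = y := by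
      rcases le_total 0 y with h | h
      · exact ⟨Real.sqrt 2, abs_of_pos hs2, by rw [abs_of_nonneg h]; field_simp⟩
      · exact ⟨-Real.sqrt 2, by rw [abs_neg, abs_of_pos hs2],
          by rw [abs_of_nonpos h]; field_simp⟩
    have hθ2 : θ ^ 2 = 2 := by rw [← sq_abs, hθ, hss]
    have key : ∀ ε ∈ Set.Ioo (0 : ℝ) r, ((-(Real.sqrt 2 * |y|) - Real.sqrt 2 * ε : ℝ) : EReal) ≤
        liminf (fun p : unitInterval ↦ ((1 / (p : ℝ) ^ (-α) : ℝ) : EReal) *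
          ENNReal.log (P {ω | rescaledRandomSum X (ν p) p α ω ∈ G})) (𝓝[>] 0) := by
      rintro ε ⟨hε, hεr⟩
      have h := le_liminf_log_measure_abs_sub_lt hX_meas hX_indep hX_ident hX_mean hX_var h0
        hν_law hν_indep hα_pos (c := |y| / Real.sqrt 2) (by positivity) hθ2 hε
      have e : 2 * (|y| / Real.sqrt 2) = Real.sqrt 2 * |y| := by
        rw [mul_div_assoc', div_eq_iff hs2.ne', mul_right_comm, ← sq, hss]
      rw [hcθ, hθ, e] at h
      refine h.trans (liminf_le_liminf (.of_forall fun p ↦ ?_))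
      refine mul_le_mul_of_nonneg_left (ENNReal.log_le_log (measure_mono fun ω hω ↦ hrG ?_)) ?_
      · rw [Metric.mem_ball, Real.dist_eq]
        exact lt_trans hω hεr
      · exact_mod_cast one_div_nonneg.2 (Real.rpow_nonneg p.2.1 _)
    have hlim : Tendsto (fun ε : ℝ ↦ ((-(Real.sqrt 2 * |y|) - Real.sqrt 2 * ε : ℝ) : EReal))
        (𝓝[>] 0) (𝓝 ((-(Real.sqrt 2 * |y|) : ℝ) : EReal)) := by
      have hcont : Continuous fun ε : ℝ ↦ -(Real.sqrt 2 * |y|) - Real.sqrt 2 * ε := by fun_prop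
      have := (continuous_coe_real_ereal.comp hcont).tendsto 0
      simp only [Function.comp, mul_zero, sub_zero] at this
      exact this.mono_left nhdsWithin_le_nhds
    refine le_of_tendsto hlim ?_
    filter_upwards [Ioo_mem_nhdsGT hr] with ε hε using key ε hε
  · rcases A.eq_empty_or_nonempty with rfl | hne
    · refine le_trans (limsup_le_of_le (a := ⊥) (by isBoundedDefault) ?_) bot_le
      filter_upwards [self_mem_nhdsWithin] with p hp
      have hp' : (0 : ℝ) < 1 / (p : ℝ) ^ (-α) := one_div_pos.2 (Real.rpow_pos_of_pos hp _)
      simp only [Set.mem_empty_iff_false, Set.ofPred_false, measure_empty, ENNReal.log_zero]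
      exact (EReal.coe_mul_bot_of_pos hp').le
    obtain ⟨y, hyA, hy⟩ := hA.exists_infDist_eq_dist hne 0
    rw [dist_zero_left, Real.norm_eq_abs] at hy
    have hmin : ∀ x ∈ A, |y| ≤ |x| := fun x hx ↦ by
      simpa [← hy] using Metric.infDist_le_dist_of_mem (x := (0 : ℝ)) hx
    have key : ∀ θ ∈ Set.Ioo 0 (Real.sqrt 2),
        limsup (fun p : unitInterval ↦ ((1 / (p : ℝ) ^ (-α) : ℝ) : EReal) *
          ENNReal.log (P {ω | rescaledRandomSum X (ν p) p α ω ∈ A})) (𝓝[>] 0) ≤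
          ((-(θ * |y|) : ℝ) : EReal) := by
      rintro θ ⟨hθ, hθ2⟩
      refine le_trans (limsup_le_limsup (.of_forall fun p ↦ ?_))
        (limsup_log_measure_le_abs_le hX_meas hX_indep hX_ident hX_mean hX_var h0 hν_law hν_indep
          hα_pos hθ (by rw [← hss]; gcongr) |y|)
      refine mul_le_mul_of_nonneg_left
        (ENNReal.log_le_log (measure_mono fun ω hω ↦ hmin _ hω)) ?_
      exact_mod_cast one_div_nonneg.2 (Real.rpow_nonneg p.2.1 _)
    have hlim : Tendsto (fun θ : ℝ ↦ ((-(θ * |y|) : ℝ) : EReal)) (𝓝[<] Real.sqrt 2)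
        (𝓝 ((-(Real.sqrt 2 * |y|) : ℝ) : EReal)) := by
      have hcont : Continuous fun θ : ℝ ↦ -(θ * |y|) := by fun_prop
      exact ((continuous_coe_real_ereal.comp hcont).tendsto _).mono_left nhdsWithin_le_nhds
    refine (ge_of_tendsto hlim (b := limsup (fun p : unitInterval ↦
      ((1 / (p : ℝ) ^ (-α) : ℝ) : EReal) *
        ENNReal.log (P {ω | rescaledRandomSum X (ν p) p α ω ∈ A})) (𝓝[>] 0)) ?_).trans ?_
    · filter_upwards [Ioo_mem_nhdsLT hs2] with θ hθ using key θ hθ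
    · rw [EReal.coe_neg, EReal.neg_le_neg_iff]
      exact iInf₂_le y hyA
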